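/- \textbf{Automata.} Let $\mathcal A=(Q,q_0,\mathcal{AP},\delta,\{\langle E_i,F_i\rangle\}_{i=1}^z)$ be a deterministic Streett automaton with finite state set $Q$, finite alphabet $\mathcal{AP}$, transition function $\delta:Q\times\mathcal{AP}\to Q$ and $E_i,F_i\subseteq Q$. Let $\mathcal A^c$ be the deterministic Rabin automaton with the same data, which accepts a word $w\in\mathcal{AP}^\omega$ iff, for some $i$, the set $\inf$ of states visited infinitely often by the run on $w$ satisfies $\inf\cap E_i\neq\emptyset$ and $\inf\cap F_i=\emptyset$ (so $\mathcal A^c$ accepts exactly the words that $\mathcal A$ rejects). Put $\sigma(q,q')=\{p\in\mathcal{AP}:\delta(q,p)=q'\}$ and $\Delta(q)=\{q':\sigma(q,q')\ne\emptyset\}$. \textbf{Run fragments and reachability elements.} Let $\mathcal R$ be the set of all finite sequences $\tilde{\mathbf q}=(q^f_0,\dots,q^f_{a_f},q^l_0,\dots,q^l_{a_l},q^l_0)$, $a_f,a_l\ge 0$, with $q^f_0=q_0$, $q^l_0\in\bigcup_iE_i$, in which each entry is followed by an element of its $\Delta$, and in which consecutive entries are distinct, with the single exception that for $a_l=0$ the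 last two entries are $q^l_0,q^l_0$ (a self-loop at $q_0^l$). For $p\in\mathcal{AP}$ let $\mathcal R^p$ be the set of those $\tilde{\mathbf q}\in\mathcal R$ whose second entry is $\delta(q_0,p)$. Let $\mathcal P^p(\tilde{\mathbf q})$ be the set of all triples of three consecutive entries of $\tilde{\mathbf q}$, and let $\mathcal P(\mathcal A^c)=\bigcup_p\bigcup_{\tilde{\mathbf q}\in\mathcal R^p}\mathcal P^p(\tilde{\mathbf q})$. \textbf{System.} Let $X\subseteq\mathbb R^n$ and $U\subseteq\mathbb R^m$ be Borel sets, $(\varsigma(k))_{k\in\mathbb N}$ i.i.d. random variables on a probability space $(\Omega,\mathbb P)$ with values in a measurable space $\mathcal V$, $f:X\times U\times\mathcal V\to X$ measurable, and $L:X\to\mathcal{AP}$ a measurable labeling function; the dynamics is $x(k+1)=f(x(k),\nu(k),\varsigma(k))$. \textbf{Certificates and controllers.} For each pair $(q,q')\in Q^2$ let $\nu_{(q,q')}:X\to U$ be a measurable controller, shared by all the elements $(q,q',q'')$. Let $C$ be a set of triples (the elements for which a certificate is available). For every $\vartheta=(q,q',q'')\in\mathcal P(\mathcal A^c)\cap C$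 assume given a control barrier certificate with controller $\nu_{(q,q')}$: a measurable $\mathbb B_\vartheta:X\to\mathbb R_{\ge0}$ and constants $0\le\eta_\vartheta<\beta_\vartheta$ such that $\mathbb B_\vartheta\le\eta_\vartheta$ on $L^{-1}(\sigma(q,q'))$, $\mathbb B_\vartheta\ge\beta_\vartheta$ on $L^{-1}(\sigma(q',q''))$, and $\mathbb E\big[\mathbb B_\vartheta(f(x,\nu_{(q,q')}(x),\varsigma(0)))\big]\le\mathbb B_\vartheta(x)$ for all $x\in X$. Put $b_\vartheta=\eta_\vartheta/\beta_\vartheta$ for $\vartheta\in C$ and $b_\vartheta=1$ for $\vartheta\notin C$. \textbf{Switching policy.} At each time $k$ the automaton reads the label $L(x(k))$, and then the input $\nu_{(q,q')}(x(k))$ is applied, where $q'$ is the automaton state after this reading and $q$ is the state from which $q'$ was last entered: the pair is $(q_0,\delta(q_0,L(x(0))))$ at time $0$; afterwards, the pair $(q,q')$ is replaced by $(q',q'')$ if the label takes $q'$ to $q''\neq q'$, and it is kept if the label is a self-loop at $q'$. Let $x^{a\varpi}$ be the resulting solution process started at $a\in X$. \textbf{Theorem.} Let $p\in\mathcal{AP}$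 with $\delta(q_0,p)\neq q_0$. Then for every initial state $a\in L^{-1}(p)$, $$\mathbb P\{L(x^{a\varpi})\text{ is accepted by }\mathcal A^c\}\ \le\ \sum_{\tilde{\mathbf q}\in\mathcal R^p}\ \prod_{\vartheta\in\mathcal P^p(\tilde{\mathbf q})}b_\vartheta ,$$ where the sum is taken in $[0,\infty]$ ($\mathcal R^p$ may be infinite). In particular, if every element of $\mathcal P(\mathcal A^c)$ carries a certificate, the bound is $\sum_{\tilde{\mathbf q}\in\mathcal R^p}\prod_{\vartheta\in\mathcal P^p(\tilde{\mathbf q})}\eta_\vartheta/\beta_\vartheta$. -/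

import Mathlib

open MeasureTheory ProbabilityTheory
open scoped NNReal ENNReal

/-! ### Deterministic Streett and Rabin automata -/

/-- The tuple `(Q, q₀, AP, δ, ⟨E₁,F₁⟩, …, ⟨E_z,F_z⟩)` shared by deterministic Streett and
deterministic Rabin automata. -/
structure PairAutomaton (Q AP : Type*) where
  q₀ : Q
  δ : Q → AP → Q
  z : ℕ
  E : Fin z → Set Q
  F : Fin z → Set Q

namespace PairAutomaton

variable {Q AP : Type*}

/-- The unique run on an infinite word: `q_{m+1} = δ (q_m, σ_m)`. -/
def run (A : PairAutomaton Q AP) (w : ℕ → AP) : ℕ → Q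
  | 0 => A.q₀
  | m + 1 => A.δ (run A w m) (w m)

/-- The states that the run on `w` visits infinitely often. -/
def infSet (A : PairAutomaton Q AP) (w : ℕ → AP) : Set Q :=
  {q | ∀ N : ℕ, ∃ m, N ≤ m ∧ A.run w m = q}

end PairAutomaton

/-- Deterministic Streett automaton. -/
structure DSA (Q AP : Type*) extends PairAutomaton Q AP

/-- Deterministic Rabin automaton. -/
structure DRA (Q AP : Type*) extends PairAutomaton Q AP

/-- Streett acceptance of an infinite word. -/
def DSA.Accepts {Q AP : Type*} (A : DSA Q AP) (w : ℕ → AP) : Prop :=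
  ∀ i : Fin A.z, A.infSet w ∩ A.E i = ∅ ∨ (A.infSet w ∩ A.F i).Nonempty

/-- Rabin acceptance of an infinite word. -/
def DRA.Accepts {Q AP : Type*} (A : DRA Q AP) (w : ℕ → AP) : Prop :=
  ∃ i : Fin A.z, (A.infSet w ∩ A.E i).Nonempty ∧ A.infSet w ∩ A.F i = ∅

/-- The complement of a DSA: the same tuple, read with the Rabin condition. -/
def DSA.compl {Q AP : Type*} (A : DSA Q AP) : DRA Q AP := ⟨A.toPairAutomaton⟩

theorem DSA.compl_accepts_iff {Q AP : Type*} (A : DSA Q AP) (w : ℕ → AP) :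
    A.compl.Accepts w ↔ ¬ A.Accepts w := by
  simp only [DRA.Accepts, DSA.Accepts, DSA.compl, not_forall, not_or,
    Set.nonempty_iff_ne_empty, ne_eq, not_not]

/-! ### Sequential reachability decomposition of a DRA -/

/-- The list of consecutive triples of a finite sequence. -/
def consecutiveTriples {Q : Type*} : List Q → List (Q × Q × Q)
  | a :: b :: c :: t => (a, b, c) :: consecutiveTriples (b :: c :: t)
  | _ => []

/-- The set of reachability elements `(q_i, q_{i+1}, q_{i+2})` of a finite run fragment. -/
def reachElements {Q : Type*} [DecidableEq Q] (t : List Q) : Finset (Q × Q × Q) :=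
  (consecutiveTriples t).toFinset

namespace DRA

variable {Q AP : Type*}

/-- `σ(q, q')`: the symbols that take the automaton from `q` to `q'` in one step. -/
def symbols (A : DRA Q AP) (q q' : Q) : Set AP := {p | A.δ q p = q'}

/-- `Δ(q)`: the states that can be reached from `q` in one step. -/
def succs (A : DRA Q AP) (q : Q) : Set Q := {q' | (A.symbols q q').Nonempty}

/-- Edges of the graph of the automaton with self-loops removed. -/
def Edge (A : DRA Q AP) (q q' : Q) : Prop := q' ≠ q ∧ q' ∈ A.succs q

/-- The finite run fragments
`(q₀ᶠ, …, q_{a_f}ᶠ, q₀ˡ, q₁ˡ, …, q_{a_l}ˡ, q₀ˡ)`, where `u = (q₀ᶠ, …, q_{a_f}ᶠ)`, `e = q₀ˡ` and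
`l = (q₁ˡ, …, q_{a_l}ˡ)`. They start in the initial state, `e` lies in some `E i`, and they do not
use self-loops, except that the loop `(e)^ω` of length one is itself closed by a self-loop. -/
def fragments (A : DRA Q AP) : Set (List Q) :=
  {t | ∃ (u l : List Q) (e : Q), t = u ++ e :: (l ++ [e]) ∧
    u.head? = some A.q₀ ∧ (∃ i, e ∈ A.E i) ∧
    (u ++ e :: l).IsChain A.Edge ∧
    ((l = [] ∧ e ∈ A.succs e) ∨ ∃ y, l.getLast? = some y ∧ A.Edge y e)}

/-- `R^p`: the fragments whose first transition `(q₀, q₁)` is taken under the symbol `p`. -/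
def fragmentsFrom (A : DRA Q AP) (p : AP) : Set (List Q) :=
  {t | t ∈ A.fragments ∧ ∃ (q₁ : Q) (s : List Q), t = A.q₀ :: q₁ :: s ∧ p ∈ A.symbols A.q₀ q₁}

/-- All reachability elements of the automaton. -/
def allReachElements [DecidableEq Q] (A : DRA Q AP) : Set (Q × Q × Q) :=
  {θ | ∃ p, ∃ t ∈ A.fragmentsFrom p, θ ∈ reachElements t}

/-- The partition set `γ_{(q, q', Δ(q'))}` of reachability elements. -/
def partitionSet [DecidableEq Q] (A : DRA Q AP) (q q' : Q) : Set (Q × Q × Q) :=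
  {θ | θ ∈ A.allReachElements ∧ ∃ q'' ∈ A.succs q', θ = (q, q', q'')}

/-- Transition function of the switching mechanism. `none` is the initial state `(q₀, Δ(q₀))` and
`some (q, q')` is the state `(q, q', Δ(q'))`, in which the automaton is in `q'` and entered `q'`
from `q`. A self-loop of the automaton leaves the switching state unchanged. The target of a
transition is never the initial state, so it is given as a pair. -/
def switch [DecidableEq Q] (A : DRA Q AP) : Option (Q × Q) → AP → Q × Q
  | none, p => (A.q₀, A.δ A.q₀ p)
  | some (q, q'), p => if A.δ q' p = q' then (q, q') else (q', A.δ q' p)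

end DRA

/-! ### Discrete-time stochastic control systems -/

/-- A discrete-time stochastic control system `(X, U, ς, f)` without internal inputs and outputs:
Borel state and input sets, i.i.d. noise on the probability space `(Ω, P)`, and a measurable
transition map. -/
structure DtSCS (n m : ℕ) {Ω : Type*} [MeasurableSpace Ω] (P : Measure Ω)
    (V : Type*) [MeasurableSpace V] where
  X : Set (Fin n → ℝ)
  measurableSet_X : MeasurableSet X
  U : Set (Fin m → ℝ)
  measurableSet_U : MeasurableSet U
  noise : ℕ → Ω → V
  measurable_noise : ∀ k, Measurable (noise k)
  indep_noise : iIndepFun noise P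
  identDistrib_noise : ∀ k, IdentDistrib (noise k) (noise 0) P P
  f : X × U × V → X
  measurable_f : Measurable f

namespace DtSCS

variable {n m : ℕ} {Ω V : Type*} [MeasurableSpace Ω] {P : Measure Ω} [MeasurableSpace V]

/-- `E[B(x(k+1)) | x(k) = x, ν(k) = u]`, the integral of `B(f(x, u, ·))` against the common law of
the noise. -/
noncomputable def nextExp (S : DtSCS n m P V) (B : S.X → ℝ≥0) (x : S.X) (u : S.U) : ℝ≥0∞ :=
  ∫⁻ v, (B (S.f (x, u, v)) : ℝ≥0∞) ∂(P.map (S.noise 0))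

/-- `B` is a control barrier certificate for the initial set `X₀` and the unsafe set `Xᵤ`, with
constants `η < β`, and the stationary policy `ν` realizes its decrease condition. -/
structure IsCBC (S : DtSCS n m P V) (X₀ Xᵤ : Set S.X) (B : S.X → ℝ≥0) (η β : ℝ≥0)
    (ν : S.X → S.U) : Prop where
  measurable : Measurable B
  lt : η < β
  initial : ∀ x ∈ X₀, B x ≤ η
  unsafe_ge : ∀ x ∈ Xᵤ, β ≤ B x
  decrease : ∀ x, S.nextExp B x (ν x) ≤ B x

variable {Q AP : Type*} [DecidableEq Q]

/-- The closed loop of the system with the switching policy `ϖ(x, q_s) = ν_{q_s'}(x)`, where `q_s'`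
is the successor of `q_s` under the label `L x`. The value at time `k` is the pair of the state
`x(k)` and of the switching state `q_s` before the label of `x(k)` is read. -/
def closedLoop (S : DtSCS n m P V) (A : DRA Q AP) (L : S.X → AP) (ν : Q × Q → S.X → S.U)
    (a : S.X) : ℕ → Ω → S.X × Option (Q × Q)
  | 0, _ => (a, none)
  | k + 1, ω =>
    let s := closedLoop S A L ν a k ω
    let g := A.switch s.2 (L s.1)
    (S.f (s.1, ν g s.1, S.noise k ω), some g)

/-- The solution process `x^{aϖ}` under the switching policy. -/
def solution (S : DtSCS n m P V) (A : DRA Q AP) (L : S.X → AP) (ν : Q × Q → S.X → S.U)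
    (a : S.X) (k : ℕ) (ω : Ω) : S.X :=
  (S.closedLoop A L ν a k ω).1

end DtSCS

/-- The bound attached to a reachability element: `η_θ / β_θ` if `θ` carries a certificate
(`θ ∈ C`), and the trivial bound `1` otherwise. -/
noncomputable def elementBound {Q : Type*} [DecidableEq Q] (C : Finset (Q × Q × Q))
    (η β : Q × Q × Q → ℝ≥0) (θ : Q × Q × Q) : ℝ≥0 :=
  if θ ∈ C then η θ / β θ else 1

/-! An accepted run visits some `e` in some `E i` infinitely often. Delete its self-loops: either
the run eventually stays at `e`, closing a loop of length one, or it leaves `e` and returns. In both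
cases a finite prefix traces a fragment of `R^p` (`DRA.Accepts.exists_completed`). Fragments are
countably many, so a union bound leaves the probability of completing one fragment `t`.

For that (`DtSCS.measure_completed_le`), a tracker of `t` is added to the closed loop, which stays a
recursion driven by i.i.d. noise. The normalized certificate `B / β` of the current triple, times
the bounds of the triples ahead, is a nonnegative supermartingale. While the run waits in a state,
the controller is unchanged and the certificate decreases in mean. At a switch, the label puts the
state both in the unsafe set of the old triple, where `B / β ≥ 1`, and in the initial set of the
next, where `B / β ≤ η / β`, so the value cannot rise. It is `1` after completion, hence Markov's
inequality bounds the probability by the initial value, at most the product over `t`. -/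

/-! ### Markov recursions driven by independent noise -/

section Markov

variable {Ω V E : Type*} [MeasurableSpace Ω] [MeasurableSpace V] [MeasurableSpace E]

theorem measurable_of_recursion {ς : ℕ → Ω → V} (hς : ∀ k, Measurable (ς k)) {G : E × V → E}
    (hG : Measurable G) {Z : ℕ → Ω → E} {z : E} (h0 : ∀ ω, Z 0 ω = z)
    (hZ : ∀ k ω, Z (k + 1) ω = G (Z k ω, ς k ω)) (k : ℕ) : Measurable (Z k) := by
  induction k with
  | zero =>
    rw [show Z 0 = fun _ => z from funext h0]
    exact measurable_const
  | succ k ih =>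
    rw [show Z (k + 1) = fun ω => G (Z k ω, ς k ω) from funext (hZ k)]
    exact hG.comp (ih.prodMk (hς k))

/-- The state at time `k` of a recursion driven by independent noise is independent of the noise
at time `k`. -/
theorem indepFun_of_recursion {P : Measure Ω} {ς : ℕ → Ω → V} (hς : ∀ k, Measurable (ς k))
    (hind : iIndepFun ς P) {G : E × V → E} (hG : Measurable G) {Z : ℕ → Ω → E} {z : E}
    (h0 : ∀ ω, Z 0 ω = z) (hZ : ∀ k ω, Z (k + 1) ω = G (Z k ω, ς k ω)) (k : ℕ) :
    IndepFun (Z k) (ς k) P := by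
  have hmeas : ∀ k, Measurable[⨆ j ∈ Set.Iio k, MeasurableSpace.comap (ς j) inferInstance]
      (Z k) := by
    intro k
    induction k with
    | zero =>
      rw [show Z 0 = fun _ => z from funext h0]
      exact @measurable_const _ _ _ _ _
    | succ k ih =>
      rw [show Z (k + 1) = fun ω => G (Z k ω, ς k ω) from funext (hZ k)]
      refine hG.comp (Measurable.prodMk (ih.mono ?_ le_rfl) ?_)
      · exact biSup_mono fun j hj => Set.mem_Iio.2 (Nat.lt_succ_of_lt hj)
      · have h : Measurable[MeasurableSpace.comap (ς k) inferInstance] (ς k) :=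
          comap_measurable _
        refine h.mono ?_ le_rfl
        exact le_biSup (fun j => MeasurableSpace.comap (ς j) inferInstance)
          (Set.mem_Iio.2 (Nat.lt_succ_self k))
  have hI := indep_iSup_of_disjoint (m := fun j => MeasurableSpace.comap (ς j) inferInstance)
    (fun j => (hς j).comap_le) hind (S := Set.Iio k) (T := {k}) (by simp)
  rw [iSup_singleton] at hI
  rw [IndepFun_iff_Indep]
  exact indep_of_indep_of_le_left hI (hmeas k).comap_le

/-- A nonnegative function that does not increase in expectation along one step of a recursion
driven by i.i.d. noise has expectation at most its initial value at all times. -/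
theorem lintegral_recursion_le {P : Measure Ω} [IsProbabilityMeasure P] {ς : ℕ → Ω → V}
    (hς : ∀ k, Measurable (ς k)) (hind : iIndepFun ς P)
    (hid : ∀ k, IdentDistrib (ς k) (ς 0) P P) {G : E × V → E} (hG : Measurable G)
    {Z : ℕ → Ω → E} {z : E} (h0 : ∀ ω, Z 0 ω = z)
    (hZ : ∀ k ω, Z (k + 1) ω = G (Z k ω, ς k ω)) {φ : E → ℝ≥0∞} (hφ : Measurable φ)
    (hdec : ∀ e, ∫⁻ v, φ (G (e, v)) ∂(P.map (ς 0)) ≤ φ e) (k : ℕ) :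
    ∫⁻ ω, φ (Z k ω) ∂P ≤ φ z := by
  have hmeas := measurable_of_recursion hς hG h0 hZ
  induction k with
  | zero => simp [h0]
  | succ k ih =>
    -- By independence the joint law is a product, so Tonelli reduces the step to `hdec` without
    -- conditional expectations.
    have hprod := (indepFun_iff_map_prod_eq_prod_map_map (hmeas k).aemeasurable
      (hς k).aemeasurable).1 (indepFun_of_recursion hς hind hG h0 hZ k)
    have : IsProbabilityMeasure (P.map (ς k)) :=
      Measure.isProbabilityMeasure_map (hς k).aemeasurable
    calc ∫⁻ ω, φ (Z (k + 1) ω) ∂P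
        = ∫⁻ ω, φ (G (Z k ω, ς k ω)) ∂P := by simp_rw [hZ]
      _ = ∫⁻ y, φ (G y) ∂(P.map fun ω => (Z k ω, ς k ω)) :=
          (lintegral_map (hφ.comp hG) ((hmeas k).prodMk (hς k))).symm
      _ = ∫⁻ e, ∫⁻ v, φ (G (e, v)) ∂(P.map (ς k)) ∂(P.map (Z k)) := by
          rw [hprod]
          exact lintegral_prod _ (hφ.comp hG).aemeasurable
      _ ≤ ∫⁻ e, φ e ∂(P.map (Z k)) := by
          rw [(hid k).map_eq]
          exact lintegral_mono hdec
      _ = ∫⁻ ω, φ (Z k ω) ∂P := lintegral_map hφ (hmeas k)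
      _ ≤ φ z := ih

end Markov

/-! ### Tracking a run fragment -/

namespace DRA

variable {Q AP : Type*}

theorem edge_run (A : DRA Q AP) {w : ℕ → AP} {k : ℕ} (h : A.run w (k + 1) ≠ A.run w k) :
    A.Edge (A.run w k) (A.run w (k + 1)) :=
  ⟨h, w k, rfl⟩

variable [DecidableEq Q]

/-- One step of the tracker of a run fragment. The list `q :: q' :: q'' :: s` means that the run
follows the fragment, has last moved from `q` to `q'`, and has still to visit `q'' :: s`. A list of
length two means that the fragment has been completed, and `[]` that the run has left it. -/
def advance (A : DRA Q AP) (g : Q × Q) : List Q → AP → List Q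
  | q :: q' :: q'' :: s, p =>
    if g = (q, q') then
      if A.δ q' p = q'' then q' :: q'' :: s
      else if A.δ q' p = q' then q :: q' :: q'' :: s else []
    else []
  | r, _ => r

/-- The switching state together with the state of the tracker of the fragment `t`, after the
label `w k` has been read. -/
def track (A : DRA Q AP) (t : List Q) (w : ℕ → AP) : ℕ → (Q × Q) × List Q
  | 0 => (A.switch none (w 0), t)
  | k + 1 => (A.switch (some (track A t w k).1) (w (k + 1)),
      A.advance (track A t w k).1 (track A t w k).2 (w (k + 1)))

/-- The fragment `t` has been completed at time `k`. -/
def Completed (A : DRA Q AP) (t : List Q) (w : ℕ → AP) (k : ℕ) : Prop :=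
  ∃ q q', (A.track t w k).2 = [q, q']

theorem Completed.succ {A : DRA Q AP} {t : List Q} {w : ℕ → AP} {k : ℕ}
    (h : A.Completed t w k) : A.Completed t w (k + 1) := by
  obtain ⟨q, q', h⟩ := h
  exact ⟨q, q', by simp [track, h, advance]⟩

/-- The states visited before the current one by the run without its self-loops. -/
def history (A : DRA Q AP) (w : ℕ → AP) : ℕ → List Q
  | 0 => [A.q₀]
  | k + 1 => if A.run w (k + 2) = A.run w (k + 1) then history A w k
      else history A w k ++ [A.run w (k + 1)]

variable {A : DRA Q AP} {w : ℕ → AP}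

/-- `history` drops stutters only from the second label on, so the first transition needs `h0`. -/
theorem isChain_history (h0 : A.run w 1 ≠ A.q₀) (k : ℕ) :
    (A.history w k ++ [A.run w (k + 1)]).IsChain A.Edge := by
  induction k with
  | zero =>
    have h : A.Edge A.q₀ (A.run w 1) := A.edge_run (k := 0) h0
    simpa [history] using h
  | succ k ih =>
    by_cases h : A.run w (k + 2) = A.run w (k + 1)
    · simpa [history, h] using ih
    · have := A.edge_run h
      simp only [history, h, if_false]
      rw [List.isChain_append]
      refine ⟨ih, by simp, ?_⟩
      simpa using this

theorem history_eq_cons (k : ℕ) :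
    ∃ s, A.history w k ++ [A.run w (k + 1)] = A.q₀ :: A.run w 1 :: s := by
  induction k with
  | zero => exact ⟨[], rfl⟩
  | succ k ih =>
    obtain ⟨s, hs⟩ := ih
    by_cases h : A.run w (k + 2) = A.run w (k + 1)
    · exact ⟨s, by simpa [history, h] using hs⟩
    · exact ⟨s ++ [A.run w (k + 2)], by simp only [history, h, if_false, hs]; simp⟩

/-- The tail matters: a fragment needs a nonempty part, starting at `q₀`, before the first `e`. -/
theorem mem_tail_history {j k : ℕ} (hjk : j ≤ k) :
    A.run w (j + 1) ∈ (A.history w k ++ [A.run w (k + 1)]).tail := by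
  induction k, hjk using Nat.le_induction with
  | base =>
    cases hj : A.history w j with
    | nil =>
      obtain ⟨s, hs⟩ := history_eq_cons (A := A) (w := w) j
      simp [hj] at hs
    | cons x l => simp
  | succ k hk ih =>
    by_cases h : A.run w (k + 2) = A.run w (k + 1)
    · simpa [history, h] using ih
    · simp only [history, h, if_false]
      exact List.mem_of_mem_dropLast (by
        rw [List.tail_append_of_ne_nil (by simp)]
        simpa using ih)

/-- The tracker follows any list that extends the history. The condition on `s` covers fragments
ending in a repeated state: if the next entry equals the current state, a self-loop consumes it, so
the tracker still awaits it only when that state has just been entered. -/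
theorem exists_track_history (A : DRA Q AP) (w : ℕ → AP) (k : ℕ) :
    ∃ c q, A.history w k = c ++ [q] ∧
      (∀ t, (A.track t w k).1 = (q, A.run w (k + 1))) ∧
      ∀ s, (s.head? ≠ some (A.run w (k + 1)) ∨ A.run w k ≠ A.run w (k + 1)) →
        (A.track (A.history w k ++ A.run w (k + 1) :: s) w k).2 = q :: A.run w (k + 1) :: s := by
  induction k with
  | zero => exact ⟨[], A.q₀, rfl, fun _ => rfl, fun _ _ => rfl⟩
  | succ k ih =>
    obtain ⟨c, q, hc, hg, hr⟩ := ih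
    have hδ : A.δ (A.run w (k + 1)) (w (k + 1)) = A.run w (k + 2) := rfl
    by_cases h : A.run w (k + 2) = A.run w (k + 1)
    · refine ⟨c, q, by simpa [history, h] using hc, fun t => ?_, fun s hs => ?_⟩
      · simp only [track, hg t, switch, hδ, h, if_true]
      · have hs' : s.head? ≠ some (A.run w (k + 1)) := by
          rcases hs with hs | hs
          · rwa [← h]
          · exact absurd h.symm hs
        have hh : A.history w (k + 1) = A.history w k := by simp [history, h]
        rw [hh, show k + 1 + 1 = k + 2 from rfl, h]
        simp only [track, hg, hr s (Or.inl hs')]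
        cases s with
        | nil => rfl
        | cons y s =>
          have hy : A.run w (k + 1) ≠ y := fun e => hs' (by simp [e])
          simp [advance, hδ, h, hy]
    · have hh : A.history w (k + 1) = A.history w k ++ [A.run w (k + 1)] := by
        simp [history, h]
      refine ⟨A.history w k, A.run w (k + 1), hh, fun t => ?_, fun s _ => ?_⟩
      · simp only [track, hg t, switch, hδ, h, if_false]
      · rw [hh, List.append_assoc, List.singleton_append]
        simp only [track, hg, hr (A.run w (k + 1 + 1) :: s) (Or.inl (by simpa using h))]
        simp [advance, hδ]

/-- The run on an accepted word completes a run fragment. -/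
theorem Accepts.exists_completed (hw : A.Accepts w) (h0 : A.run w 1 ≠ A.q₀) :
    ∃ t ∈ A.fragmentsFrom (w 0), ∃ k, A.Completed t w k := by
  obtain ⟨i, ⟨e, he, hei⟩, -⟩ := hw
  by_cases hconst : ∃ k, ∀ j ≥ k, A.run w (j + 1) = e
  · classical
    -- Minimality makes step `k` the final entry into `e`, so the closing self-loop has not yet been
    -- consumed.
    let k := Nat.find hconst
    have hk : ∀ j ≥ k, A.run w (j + 1) = e := Nat.find_spec hconst
    have hke := hk k le_rfl
    have hne : A.run w k ≠ A.run w (k + 1) := by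
      rcases hk0 : k with _ | l
      · exact fun h => h0 h.symm
      · intro h
        refine Nat.find_min hconst (m := l) (by change l < k; omega) fun j hj => ?_
        rcases hj.eq_or_lt with rfl | hj
        · rw [h, ← hk0, hke]
        · exact hk j (by omega)
    obtain ⟨c, q, hc, hg, hr⟩ := exists_track_history A w k
    have hloop : A.δ e (w (k + 1)) = e := by
      rw [← hke]
      exact (hk (k + 1) (Nat.le_succ k)).trans hke.symm
    obtain ⟨s, hs⟩ := history_eq_cons (A := A) (w := w) k
    have hch := isChain_history h0 k
    refine ⟨A.history w k ++ e :: ([] ++ [e]), ⟨⟨A.history w k, [], e, rfl, ?_, ⟨i, hei⟩, ?_,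
      Or.inl ⟨rfl, w (k + 1), hloop⟩⟩, A.run w 1, s ++ [e], ?_, rfl⟩, k + 1, e, e, ?_⟩
    · cases hh : A.history w k with
      | nil => simp [hh] at hs
      | cons x l => simp only [hh, List.cons_append, List.cons.injEq] at hs; simp [hs.1]
    · rwa [hke] at hch
    · rw [hke] at hs
      rw [List.nil_append, List.append_cons, hs]; rfl
    · have := hr [e] (Or.inr hne)
      rw [hke] at this
      simp [track, this, hg, hke, advance, hloop]
  · push Not at hconst
    -- A visit at positive time is taken, so that `e` lies in the tail of the history.
    obtain ⟨j, hj1, hj⟩ := he 1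
    obtain ⟨j, rfl⟩ : ∃ j', j = j' + 1 := ⟨j - 1, by omega⟩
    obtain ⟨l, hl, hle⟩ := hconst j
    have hex : ∃ d, A.run w (l + d + 2) = e := by
      obtain ⟨m, hm, hme⟩ := he (l + 2)
      exact ⟨m - (l + 2), by rw [← hme]; congr 1; omega⟩
    classical
    -- The first return to `e` after the departure seen at time `l + 1`.
    obtain ⟨k, hjk, hk, hke⟩ : ∃ k, j ≤ k ∧ A.run w (k + 1) ≠ e ∧ A.run w (k + 2) = e := by
      refine ⟨l + Nat.find hex, by omega, ?_, Nat.find_spec hex⟩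
      rcases hd : Nat.find hex with _ | d
      · exact hle
      · exact Nat.find_min hex (m := d) (by omega)
    have hne : A.run w (k + 2) ≠ A.run w (k + 1) := fun h => hk (h ▸ hke)
    have hh : A.history w (k + 1) = A.history w k ++ [A.run w (k + 1)] := by
      simp [history, hne]
    obtain ⟨c, q, hc, hg, hr⟩ := exists_track_history A w (k + 1)
    have hmem := mem_tail_history (A := A) (w := w) hjk
    rw [hj, ← hh] at hmem
    obtain ⟨s, hs⟩ := history_eq_cons (A := A) (w := w) (k + 1)
    have hch := isChain_history h0 (k + 1)
    rw [show k + 1 + 1 = k + 2 from rfl, hke] at hs hch hg hr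
    cases hH : A.history w (k + 1) with
    | nil => simp [hH] at hmem
    | cons x v =>
      rw [hH] at hmem hs hch hc hr
      obtain ⟨u, l', rfl⟩ := List.append_of_mem (show e ∈ v from hmem)
      obtain rfl : x = A.q₀ := by simpa using (List.cons.inj hs).1
      have hl' : l' ≠ [] := by
        rintro rfl
        have h1 : (A.q₀ :: (u ++ [e])).getLast? = some e := by
          rw [← List.cons_append, List.getLast?_concat]
        rw [← hH, hh, List.getLast?_concat] at h1
        exact hk (Option.some.inj h1)
      refine ⟨A.q₀ :: (u ++ e :: l') ++ [e], ⟨⟨A.q₀ :: u, l', e, by simp, rfl, ⟨i, hei⟩, ?_,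
        Or.inr ⟨l'.getLast hl', List.getLast?_eq_getLast_of_ne_nil hl', ?_⟩⟩,
        A.run w 1, s, hs, rfl⟩, k + 1, q, e, hr [] (Or.inl (by simp))⟩
      · simpa using (List.isChain_append.1 hch).1
      · refine (List.isChain_append.1 hch).2.2 _ ?_ _ (by simp)
        rw [List.getLast?_cons, List.getLast?_append]
        simp [List.getLast?_cons, List.getLast?_eq_getLast_of_ne_nil hl']

end DRA

/-! ### The supermartingale attached to a run fragment -/

/-- The product of `b` over the consecutive triples of a list, with multiplicity. -/
noncomputable def tripleWeight {Q : Type*} (b : Q × Q × Q → ℝ≥0∞) (r : List Q) : ℝ≥0∞ :=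
  ((consecutiveTriples r).map b).prod

theorem tripleWeight_cons {Q : Type*} (b : Q × Q × Q → ℝ≥0∞) (q q' q'' : Q) (s : List Q) :
    tripleWeight b (q :: q' :: q'' :: s) = b (q, q', q'') * tripleWeight b (q' :: q'' :: s) := by
  simp [tripleWeight, consecutiveTriples]

/-- The supermartingale pays for each repetition of a triple; the stated bound counts it once, which
is weaker because factors are at most `1`. -/
theorem List.prod_map_le_prod_toFinset {ι : Type*} [DecidableEq ι] {b : ι → ℝ≥0∞}
    (hb : ∀ i, b i ≤ 1) (l : List ι) : (l.map b).prod ≤ ∏ i ∈ l.toFinset, b i := by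
  induction l with
  | nil => simp
  | cons x l ih =>
    rw [List.map_cons, List.prod_cons, List.toFinset_cons]
    by_cases hx : x ∈ l.toFinset
    · rw [Finset.insert_eq_of_mem hx]
      exact (mul_le_of_le_one_left' (hb x)).trans ih
    · rw [Finset.prod_insert hx]
      exact mul_le_mul_right ih _

section Value

variable {Q X : Type*}

/-- The value of the tracker of a run fragment: `1` once the fragment has been completed, `0` once
the run has left it, and in between the value of the current function `ψ θ`, multiplied by the
bounds `b` of the reachability elements that are still ahead. -/
noncomputable def trackerValue (ψ : Q × Q × Q → X → ℝ≥0∞) (b : Q × Q × Q → ℝ≥0∞) :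
    List Q → X → ℝ≥0∞
  | q :: q' :: q'' :: s, x => ψ (q, q', q'') x * tripleWeight b (q' :: q'' :: s)
  | [_, _], _ => 1
  | _, _ => 0

variable {ψ : Q × Q × Q → X → ℝ≥0∞} {b : Q × Q × Q → ℝ≥0∞}

theorem measurable_trackerValue [MeasurableSpace X] (hψ : ∀ θ, Measurable (ψ θ)) (r : List Q) :
    Measurable (trackerValue ψ b r) := by
  rcases r with _ | ⟨q, _ | ⟨q', _ | ⟨q'', s⟩⟩⟩
  · exact measurable_const
  · exact measurable_const
  · exact measurable_const
  · exact (hψ _).mul_const _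

variable {AP : Type*} {A : DRA Q AP} {L : X → AP}

theorem trackerValue_le_tripleWeight
    (hinit : ∀ q q' q'' x, L x ∈ A.symbols q q' → ψ (q, q', q'') x ≤ b (q, q', q''))
    {q q' : Q} (s : List Q) {x : X} (hx : L x ∈ A.symbols q q') :
    trackerValue ψ b (q :: q' :: s) x ≤ tripleWeight b (q :: q' :: s) := by
  cases s with
  | nil => simp [trackerValue, tripleWeight, consecutiveTriples]
  | cons q'' s =>
    rw [tripleWeight_cons]
    exact mul_le_mul_left (hinit q q' q'' x hx) _

/-- At a switch the old factor is at least `1` by `hfin`, and the same label bounds the new factor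
by `b` through `hinit`. Completion is the case where no triple remains. -/
theorem trackerValue_advance_le [DecidableEq Q]
    (hinit : ∀ q q' q'' x, L x ∈ A.symbols q q' → ψ (q, q', q'') x ≤ b (q, q', q''))
    (hfin : ∀ q q' q'' x, L x ∈ A.symbols q' q'' → 1 ≤ ψ (q, q', q'') x)
    (q q' q'' : Q) (s : List Q) (x : X) :
    trackerValue ψ b (A.advance (q, q') (q :: q' :: q'' :: s) (L x)) x ≤
      trackerValue ψ b (q :: q' :: q'' :: s) x := by
  simp only [DRA.advance, if_true]
  split_ifs with h1 h2
  · exact (trackerValue_le_tripleWeight hinit _ h1).trans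
      (le_mul_of_one_le_left' (hfin q q' q'' x h1))
  · exact le_rfl
  · exact zero_le

end Value

/-! ### The closed loop together with the tracker -/

namespace DtSCS

variable {n m : ℕ} {Ω V Q AP : Type*} [MeasurableSpace Ω] [MeasurableSpace V] {P : Measure Ω}
  [DecidableEq Q]

/-- One step of the closed loop of the system, the switching mechanism and the tracker of a run
fragment. -/
def trackedStep (S : DtSCS n m P V) (A : DRA Q AP) (L : S.X → AP) (ν : Q × Q → S.X → S.U)
    (y : (S.X × ((Q × Q) × List Q)) × V) : S.X × ((Q × Q) × List Q) :=
  let x := S.f (y.1.1, ν y.1.2.1 y.1.1, y.2)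
  (x, A.switch (some y.1.2.1) (L x), A.advance y.1.2.1 y.1.2.2 (L x))

theorem measurable_trackedStep [Countable Q] [MeasurableSpace ((Q × Q) × List Q)]
    [DiscreteMeasurableSpace ((Q × Q) × List Q)] [Countable AP]
    (S : DtSCS n m P V) (A : DRA Q AP) {L : S.X → AP} (hL : ∀ p, MeasurableSet (L ⁻¹' {p}))
    {ν : Q × Q → S.X → S.U} (hν : ∀ g, Measurable (ν g)) :
    Measurable (S.trackedStep A L ν) := by
  let _ : MeasurableSpace AP := ⊤
  have hL' : Measurable L := measurable_to_countable' hL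
  have key : Measurable fun y : ((Q × Q) × List Q) × (S.X × V) =>
      S.trackedStep A L ν ((y.2.1, y.1), y.2.2) := by
    refine measurable_from_prod_countable_right fun d => ?_
    have hx : Measurable fun y : S.X × V => S.f (y.1, ν d.1 y.1, y.2) :=
      S.measurable_f.comp (measurable_fst.prodMk
        (((hν d.1).comp measurable_fst).prodMk measurable_snd))
    refine hx.prodMk ?_
    exact (measurable_from_top (f := fun p => (A.switch (some d.1) p, A.advance d.1 d.2 p))).comp
      (hL'.comp hx)
  exact key.comp ((measurable_snd.comp measurable_fst).prodMk
    ((measurable_fst.comp measurable_fst).prodMk measurable_snd))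

/-- The closed loop at time `k`, with the state of the tracker of `t` after the label at time `k`
has been read. -/
def tracked (S : DtSCS n m P V) (A : DRA Q AP) (L : S.X → AP) (ν : Q × Q → S.X → S.U)
    (a : S.X) (t : List Q) (k : ℕ) (ω : Ω) : S.X × ((Q × Q) × List Q) :=
  (S.solution A L ν a k ω, A.track t (fun j => L (S.solution A L ν a j ω)) k)

/-- Aligns two conventions: `closedLoop` stores the switching state before the label is read,
`track` after. -/
theorem switch_closedLoop (S : DtSCS n m P V) (A : DRA Q AP) (L : S.X → AP)
    (ν : Q × Q → S.X → S.U) (a : S.X) (t : List Q) (k : ℕ) (ω : Ω) :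
    A.switch (S.closedLoop A L ν a k ω).2 (L (S.closedLoop A L ν a k ω).1) =
      (A.track t (fun j => L (S.solution A L ν a j ω)) k).1 := by
  induction k with
  | zero => rfl
  | succ k ih =>
    rw [DRA.track, ← ih]
    rfl

theorem tracked_succ (S : DtSCS n m P V) (A : DRA Q AP) (L : S.X → AP)
    (ν : Q × Q → S.X → S.U) (a : S.X) (t : List Q) (k : ℕ) (ω : Ω) :
    S.tracked A L ν a t (k + 1) ω =
      S.trackedStep A L ν (S.tracked A L ν a t k ω, S.noise k ω) := by
  have h : S.solution A L ν a (k + 1) ω =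
      S.f (S.solution A L ν a k ω,
        ν (A.track t (fun j => L (S.solution A L ν a j ω)) k).1 (S.solution A L ν a k ω),
        S.noise k ω) := by
    rw [← switch_closedLoop]
    rfl
  simp only [trackedStep, tracked, ← h]
  rfl

/-- The probability that the closed loop completes a run fragment is at most the product of the
bounds of its consecutive triples. -/
theorem measure_completed_le [IsProbabilityMeasure P] [Countable Q] [Countable AP]
    (S : DtSCS n m P V) (A : DRA Q AP)
    {L : S.X → AP} (hL : ∀ p, MeasurableSet (L ⁻¹' {p}))
    {ν : Q × Q → S.X → S.U} (hν : ∀ g, Measurable (ν g))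
    {ψ : Q × Q × Q → S.X → ℝ≥0∞} {b : Q × Q × Q → ℝ≥0∞} (hψ : ∀ θ, Measurable (ψ θ))
    (hinit : ∀ q q' q'' x, L x ∈ A.symbols q q' → ψ (q, q', q'') x ≤ b (q, q', q''))
    (hfin : ∀ q q' q'' x, L x ∈ A.symbols q' q'' → 1 ≤ ψ (q, q', q'') x)
    (hdec : ∀ q q' q'' x, ∫⁻ v, ψ (q, q', q'') (S.f (x, ν (q, q') x, v)) ∂(P.map (S.noise 0)) ≤
      ψ (q, q', q'') x)
    (a : S.X) {q₀ q₁ : Q} {s : List Q} (ha : L a ∈ A.symbols q₀ q₁) :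
    P {ω | ∃ k, A.Completed (q₀ :: q₁ :: s) (fun j => L (S.solution A L ν a j ω)) k} ≤
      tripleWeight b (q₀ :: q₁ :: s) := by
  set t := q₀ :: q₁ :: s with ht
  let _ : MeasurableSpace ((Q × Q) × List Q) := ⊤
  have : DiscreteMeasurableSpace ((Q × Q) × List Q) := ⟨fun _ => trivial⟩
  have : IsProbabilityMeasure (P.map (S.noise 0)) :=
    Measure.isProbabilityMeasure_map (S.measurable_noise 0).aemeasurable
  let φ : S.X × ((Q × Q) × List Q) → ℝ≥0∞ := fun y => trackerValue ψ b y.2.2 y.1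
  have hφ : Measurable φ :=
    measurable_from_prod_countable_left fun d => measurable_trackerValue hψ d.2
  have hstep : ∀ y, ∫⁻ v, φ (S.trackedStep A L ν (y, v)) ∂(P.map (S.noise 0)) ≤ φ y := by
    rintro ⟨x, g, r⟩
    rcases r with _ | ⟨q, _ | ⟨q', _ | ⟨q'', s⟩⟩⟩
    · simp [φ, trackedStep, DRA.advance, trackerValue]
    · simp [φ, trackedStep, DRA.advance, trackerValue]
    · simp [φ, trackedStep, DRA.advance, trackerValue]
    -- The decrease is required at every state, reachable or not. If `g` differs from the awaited
    -- pair, the applied controller need not suit the certificate, but `advance` then returns `[]`,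
    -- of value `0`.
    · by_cases hg : g = (q, q')
      · subst hg
        have hx : Measurable fun v => S.f (x, ν (q, q') x, v) :=
          S.measurable_f.comp (measurable_const.prodMk (measurable_const.prodMk measurable_id))
        calc ∫⁻ v, φ (S.trackedStep A L ν ((x, (q, q'), q :: q' :: q'' :: s), v))
              ∂(P.map (S.noise 0))
            ≤ ∫⁻ v, ψ (q, q', q'') (S.f (x, ν (q, q') x, v)) * tripleWeight b (q' :: q'' :: s)
              ∂(P.map (S.noise 0)) :=
              lintegral_mono fun v => trackerValue_advance_le hinit hfin q q' q'' s _
          _ ≤ φ (x, (q, q'), q :: q' :: q'' :: s) := by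
              refine (lintegral_mul_const _ ((hψ _).comp hx)).trans_le ?_
              exact mul_le_mul_left (hdec q q' q'' x) _
      · simp [φ, trackedStep, DRA.advance, trackerValue, hg]
  have hbound : ∀ k, P {ω | A.Completed t (fun j => L (S.solution A L ν a j ω)) k} ≤
      tripleWeight b t := by
    intro k
    have hk := lintegral_recursion_le (φ := φ) (Z := S.tracked A L ν a t)
      (z := (a, A.switch none (L a), t)) S.measurable_noise S.indep_noise S.identDistrib_noise
      (S.measurable_trackedStep A hL hν) (fun _ => rfl) (S.tracked_succ A L ν a t) hφ hstep k
    calc P {ω | A.Completed t (fun j => L (S.solution A L ν a j ω)) k}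
        ≤ P {ω | 1 ≤ φ (S.tracked A L ν a t k ω)} := by
          refine measure_mono fun ω hω => ?_
          obtain ⟨q, q', h⟩ := hω
          simp [φ, tracked, h, trackerValue]
      _ ≤ ∫⁻ ω, φ (S.tracked A L ν a t k ω) ∂P := by
          simpa using mul_meas_ge_le_lintegral (μ := P) (hφ.comp (measurable_of_recursion
            (z := (a, A.switch none (L a), t)) S.measurable_noise (S.measurable_trackedStep A hL hν) (fun _ => rfl)
            (S.tracked_succ A L ν a t) k)) 1
      _ ≤ φ (a, A.switch none (L a), t) := hk
      _ ≤ tripleWeight b t := trackerValue_le_tripleWeight hinit s ha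
  -- Completion is permanent, so continuity from below turns the bound at each fixed time into one
  -- for completion at any time.
  have hmono : Monotone fun k =>
      {ω | A.Completed t (fun j => L (S.solution A L ν a j ω)) k} :=
    monotone_nat_of_le_succ fun k ω hω => DRA.Completed.succ hω
  rw [Set.ofPred_exists, hmono.measure_iUnion]
  exact iSup_le hbound

end DtSCS

/-! ### Reachability elements of fragments -/

theorem isChain_succs_of_mem_fragments {Q AP : Type*} {A : DRA Q AP} {t : List Q}
    (ht : t ∈ A.fragments) : t.IsChain fun q q' => q' ∈ A.succs q := by
  obtain ⟨u, l, e, rfl, -, -, hch, hlast⟩ := ht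
  rw [← List.cons_append, ← List.append_assoc]
  refine List.isChain_append.2 ⟨hch.imp fun _ _ h => h.2, by simp, fun x hx y hy => ?_⟩
  obtain rfl : e = y := by simpa using hy
  rcases hlast with ⟨rfl, he⟩ | ⟨z, hz, hze⟩
  · obtain rfl : e = x := by simpa using hx
    exact he
  · obtain rfl : z = x := by simpa [List.getLast?_append, List.getLast?_cons, hz] using hx
    exact hze.2

theorem rel_of_mem_consecutiveTriples {Q : Type*} {R : Q → Q → Prop} {q q' q'' : Q} :
    ∀ {t : List Q}, t.IsChain R → (q, q', q'') ∈ consecutiveTriples t → R q' q''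
  | a :: b :: c :: t, ht, h => by
    rw [consecutiveTriples, List.mem_cons] at h
    rw [List.isChain_cons_cons] at ht
    rcases h with h | h
    · obtain ⟨rfl, rfl, rfl⟩ : q = a ∧ q' = b ∧ q'' = c := by simpa using h
      exact (List.isChain_cons_cons.1 ht.2).1
    · exact rel_of_mem_consecutiveTriples ht.2 h
  | [], _, h => by simp [consecutiveTriples] at h
  | [_], _, h => by simp [consecutiveTriples] at h
  | [_, _], _, h => by simp [consecutiveTriples] at h

theorem mem_partitionSet_of_mem_reachElements {Q AP : Type*} [DecidableEq Q] {A : DRA Q AP}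
    {p : AP} {t : List Q} (ht : t ∈ A.fragmentsFrom p) {q q' q'' : Q}
    (h : (q, q', q'') ∈ reachElements t) : (q, q', q'') ∈ A.partitionSet q q' :=
  ⟨⟨p, t, ht, h⟩, q'', rel_of_mem_consecutiveTriples (isChain_succs_of_mem_fragments ht.1)
    (List.mem_toFinset.1 h), rfl⟩

theorem mainTheorem3 {n m : ℕ} {Ω V Q AP : Type*} [MeasurableSpace Ω] [MeasurableSpace V]
    [Fintype Q] [DecidableEq Q] [Fintype AP]
    (P : Measure Ω) [IsProbabilityMeasure P]
    (S : DtSCS n m P V)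
    (A : DSA Q AP)
    (L : S.X → AP) (hL : ∀ p, MeasurableSet (L ⁻¹' {p}))
    -- one measurable stationary controller per partition set
    (ν : Q × Q → S.X → S.U) (hν : ∀ g, Measurable (ν g))
    -- the reachability elements in `C` carry control barrier certificates
    (C : Finset (Q × Q × Q)) (B : Q × Q × Q → S.X → ℝ≥0) (η β : Q × Q × Q → ℝ≥0)
    (hCBC : ∀ q q' q'' : Q, (q, q', q'') ∈ A.compl.partitionSet q q' → (q, q', q'') ∈ C →
      S.IsCBC (L ⁻¹' A.compl.symbols q q') (L ⁻¹' A.compl.symbols q' q'')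
        (B (q, q', q'')) (η (q, q', q'')) (β (q, q', q'')) (ν (q, q')))
    (p : AP) (hp : A.compl.δ A.compl.q₀ p ≠ A.compl.q₀)
    (a : S.X) (ha : L a = p) :
    P {ω | A.compl.Accepts (fun k => L (S.solution A.compl L ν a k ω))} ≤
      ∑' t : A.compl.fragmentsFrom p,
        ∏ θ ∈ reachElements t.1, (elementBound C η β θ : ℝ≥0∞) := by
  classical
  -- Nothing is known about `η` and `β` on triples of `C` that occur in no fragment. Giving these
  -- the constant function `1` makes the estimates hold for all triples, and `b` still agrees with
  -- `elementBound` on the fragments.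
  let cert : Q × Q × Q → Prop := fun θ => θ ∈ A.compl.partitionSet θ.1 θ.2.1 ∧ θ ∈ C
  have hcert : ∀ q q' q'', cert (q, q', q'') → _ := fun q q' q'' h => hCBC q q' q'' h.1 h.2
  let ψ : Q × Q × Q → S.X → ℝ≥0∞ := fun θ x => if cert θ then (B θ x : ℝ≥0∞) / β θ else 1
  let b : Q × Q × Q → ℝ≥0∞ := fun θ => if cert θ then (η θ : ℝ≥0∞) / β θ else 1
  have hψ : ∀ θ, Measurable (ψ θ) := by
    rintro ⟨q, q', q''⟩
    by_cases h : cert (q, q', q'')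
    · simpa only [ψ, h, if_true] using
        (hcert q q' q'' h).measurable.coe_nnreal_ennreal.div_const _
    · simp only [ψ, h, if_false, measurable_const]
  have hb : ∀ θ, b θ ≤ 1 := by
    rintro ⟨q, q', q''⟩
    by_cases h : cert (q, q', q'')
    · simp only [b, h, if_true]
      exact ENNReal.div_le_of_le_mul (by simpa using (hcert q q' q'' h).lt.le)
    · simp only [b, h, if_false, le_rfl]
  have hinit : ∀ q q' q'' x, L x ∈ A.compl.symbols q q' → ψ (q, q', q'') x ≤ b (q, q', q'') := by
    intro q q' q'' x hx
    by_cases h : cert (q, q', q'')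
    · simp only [ψ, b, h, if_true]
      exact ENNReal.div_le_div_right (by exact_mod_cast (hcert q q' q'' h).initial x hx) _
    · simp only [ψ, b, h, if_false, le_rfl]
  have hfin : ∀ q q' q'' x, L x ∈ A.compl.symbols q' q'' → 1 ≤ ψ (q, q', q'') x := by
    intro q q' q'' x hx
    by_cases h : cert (q, q', q'')
    · simp only [ψ, h, if_true]
      have hβ : (β (q, q', q'') : ℝ≥0∞) ≠ 0 := by
        exact_mod_cast (pos_of_gt (hcert q q' q'' h).lt).ne'
      rw [ENNReal.le_div_iff_mul_le (Or.inl hβ) (Or.inl ENNReal.coe_ne_top), one_mul]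
      exact_mod_cast (hcert q q' q'' h).unsafe_ge x hx
    · simp only [ψ, h, if_false, le_rfl]
  have : IsProbabilityMeasure (P.map (S.noise 0)) :=
    Measure.isProbabilityMeasure_map (S.measurable_noise 0).aemeasurable
  have hdec : ∀ q q' q'' x,
      ∫⁻ v, ψ (q, q', q'') (S.f (x, ν (q, q') x, v)) ∂(P.map (S.noise 0)) ≤ ψ (q, q', q'') x := by
    intro q q' q'' x
    by_cases h : cert (q, q', q'')
    · have hx : Measurable fun v => S.f (x, ν (q, q') x, v) :=
        S.measurable_f.comp (measurable_const.prodMk (measurable_const.prodMk measurable_id))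
      simp only [ψ, h, if_true, div_eq_mul_inv]
      refine (lintegral_mul_const _
        ((hcert q q' q'' h).measurable.coe_nnreal_ennreal.comp hx)).trans_le ?_
      exact mul_le_mul_left ((hcert q q' q'' h).decrease x) _
    · simp [ψ, h]
  have hcover : {ω | A.compl.Accepts (fun k => L (S.solution A.compl L ν a k ω))} ⊆
      ⋃ t : A.compl.fragmentsFrom p,
        {ω | ∃ k, A.compl.Completed t.1 (fun j => L (S.solution A.compl L ν a j ω)) k} := by
    intro ω hω
    have h0 : L (S.solution A.compl L ν a 0 ω) = p := ha
    obtain ⟨t, ht, hk⟩ := DRA.Accepts.exists_completed hω (by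
      change A.compl.δ A.compl.q₀ (L (S.solution A.compl L ν a 0 ω)) ≠ _
      rwa [h0])
    rw [h0] at ht
    exact Set.mem_iUnion.2 ⟨⟨t, ht⟩, hk⟩
  -- The union is countable, since the fragments are lists over a finite set.
  refine (measure_mono hcover).trans ((measure_iUnion_le _).trans (ENNReal.tsum_le_tsum ?_))
  rintro ⟨t, ht⟩
  obtain ⟨q₁, s, hts, hq₁⟩ := ht.2
  have hle := S.measure_completed_le A.compl hL hν hψ hinit hfin hdec a (s := s) (ha ▸ hq₁)
  rw [← hts] at hle
  refine hle.trans ((List.prod_map_le_prod_toFinset hb _).trans (le_of_eq ?_))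
  refine Finset.prod_congr rfl ?_
  rintro ⟨q, q', q''⟩ hθ
  have hpart := mem_partitionSet_of_mem_reachElements ht hθ
  by_cases hC : (q, q', q'') ∈ C
  · have hc : cert (q, q', q'') := ⟨hpart, hC⟩
    have hβ : β (q, q', q'') ≠ 0 := (pos_of_gt (hcert q q' q'' hc).lt).ne'
    simp only [b, hc, elementBound, hC, if_true, ENNReal.coe_div hβ]
  · have hc : ¬ cert (q, q', q'') := fun h => hC h.2
    simp only [b, hc, elementBound, hC, if_false, ENNReal.coe_one]
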